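/- Let $K$ be an algebraically closed field, $X$ a finite set of variables, $H,T\subseteq K[X]$ ideals, and $U\subseteq X$ a set of variables that is independent for $H$, i.e. $H\cap K[U]=(0)$, with $|U|=\dim K[X]/H$ (Krull dimension). Fix a monomial order on the variables $X\setminus U$, and regard the ideal $H+T$ as an ideal $I$ of $K[U][X\setminus U]$, with the variables in $U$ as parameters; for $u\in K^U$ let $\sigma_u:K[U][X\setminus U]\to K[X\setminus U]$ denote the specialization of the parameters at $u$. A *minimal canonical comprehensive Gröbner system* (MCCGS) of $\{H,T\}$ with respect to $U$ is a finite set of pairs $(S_i,B_i)$ such that: the $S_i$ (the segments) are nonempty constructible sets that partition $K^U$; each $B_i\subset K[U][X\setminus U]$ is a finite set of polynomials with content $1$ over $K[U]$ (polynomials being taken up to nonzero constants of $K$) and pairwise distinct leading power products, whose leading coefficients vanish at no point of $S_i$, and such that for every $u\in S_i$ the polynomials of $\sigma_u(B_i)$, made monic, form the reduced Gröbner basis of $\sigma_u(I)$; and the number of segments is the least possible among all systems with these properties. A segment is *generic* if it contains a nonempty Zariski-open subset of $K^U$. Then the following hold. 1. $T$ vanishes identically on some irreducible component $C$ of $\mathbb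 V(H)\subseteq K^X$ on which $U$ is independent (no nonzero polynomial of $K[U]$ vanishes on $C$) if and only if $(H+T)\cap K[U]=(0)$. 2. Every MCCGS of $\{H,T\}$ with respect to $U$ has exactly one generic segment, and $T$ vanishes identically on some irreducible component of $\mathbb V(H)$ on which $U$ is independent if and only if the basis $B$ of the generic segment is different from $1$, i.e. $B$ is not of the form $\{c\}$ with $c\in K\setminus\{0\}$. -/

import Mathlib

open MvPolynomial

noncomputable section

namespace ParametricGroebner

/-! ### Affine varieties over `K` -/

/-- The Zariski topology on affine space `σ → K`: the closed sets are the zero loci of ideals. -/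
@[reducible] def zariski (K σ : Type*) [Field K] : TopologicalSpace (σ → K) :=
  TopologicalSpace.ofClosed {Z | ∃ I : Ideal (MvPolynomial σ K), Z = zeroLocus K I}
    ⟨⊤, by simp⟩
    (by
      intro A hA
      refine ⟨sSup {I | zeroLocus K I ∈ A}, ?_⟩
      ext x
      simp only [Set.mem_sInter]
      constructor
      · intro h
        have : sSup {I : Ideal (MvPolynomial σ K) | zeroLocus K I ∈ A} ≤ vanishingIdeal K {x} :=
          sSup_le fun I hI p hp => (mem_vanishingIdeal_singleton_iff x p).2 (h _ hI p hp)
        exact fun p hp => (mem_vanishingIdeal_singleton_iff x p).1 (this hp)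
      · intro h Z hZ
        obtain ⟨I, rfl⟩ := hA hZ
        exact fun p hp => h p ((le_sSup (show I ∈ {I | zeroLocus K I ∈ A} from hZ)) hp))
    (by
      rintro _ ⟨I, rfl⟩ _ ⟨J, rfl⟩
      refine ⟨I ⊓ J, ?_⟩
      ext x
      constructor
      · rintro (h | h) p hp
        · exact h p hp.1
        · exact h p hp.2
      · intro h
        by_contra hx
        simp only [Set.mem_union, mem_zeroLocus_iff, not_or, not_forall] at hx
        obtain ⟨⟨p, hp, hpx⟩, ⟨q, hq, hqx⟩⟩ := hx
        have := h (p * q) ⟨I.mul_mem_right _ hp, J.mul_mem_left _ hq⟩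
        rw [map_mul] at this
        exact (mul_ne_zero hpx hqx) this)

/-- `C` is an irreducible component of `V` (for the Zariski topology): a maximal irreducible
subset of `V`. -/
def IsComponent {K σ : Type*} [Field K] (V C : Set (σ → K)) : Prop :=
  Maximal (fun Z => @IsIrreducible _ (zariski K σ) Z ∧ Z ⊆ V) C

/-- The variables `U` are independent for the ideal `I`: `I ∩ K[U] = 0`. -/
def IsIndependent {K σ : Type*} [Field K] (U : Finset σ) (I : Ideal (MvPolynomial σ K)) : Prop :=
  I.comap (rename ((↑) : {i // i ∈ U} → σ) : MvPolynomial {i // i ∈ U} K →ₐ[K] MvPolynomial σ K)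
    = ⊥

/-- Every polynomial of `T` vanishes at every point of `C`. -/
def VanishesOn {K σ : Type*} [Field K] (T : Ideal (MvPolynomial σ K)) (C : Set (σ → K)) : Prop :=
  ∀ t ∈ T, ∀ x ∈ C, eval x t = 0

/-- `T` vanishes identically on some irreducible component of the variety of `H` on which the
variables `U` remain independent (no nonzero polynomial in `K[U]` vanishes on the component). -/
def VanishesOnSomeIndependentComponent {K σ : Type*} [Field K] (U : Finset σ)
    (H T : Ideal (MvPolynomial σ K)) : Prop :=
  ∃ C, IsComponent (zeroLocus K H) C ∧ IsIndependent U (vanishingIdeal K C) ∧ VanishesOn T C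

/-! ### Reduced Gröbner bases over a field -/

/-- `B` is the reduced Gröbner basis of the ideal `J` with respect to the monomial order `m`. -/
structure IsReducedGroebnerBasis {K τ : Type*} [Field K] (m : MonomialOrder τ)
    (J : Ideal (MvPolynomial τ K)) (B : Set (MvPolynomial τ K)) : Prop where
  finite : B.Finite
  subset : B ⊆ J
  exists_degree_le : ∀ f ∈ J, f ≠ 0 → ∃ b ∈ B, m.degree b ≤ m.degree f
  monic : ∀ b ∈ B, m.leadingCoeff b = 1
  reduced : ∀ b ∈ B, ∀ b' ∈ B, b ≠ b' → ∀ c ∈ b.support, ¬ m.degree b' ≤ c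

/-! ### Parametric ideals and comprehensive Gröbner systems

`π` is the type of parameters and `τ` the type of variables. -/

/-- The specialization `K[π][τ] → K[τ]` of the parameters at the point `u`. -/
def specialize {K π τ : Type*} [Field K] (u : π → K) :
    MvPolynomial τ (MvPolynomial π K) →+* MvPolynomial τ K :=
  MvPolynomial.map (eval u)

/-- A segment of a Gröbner system: a subset of the parameter space with its basis. -/
structure Segment (K π τ : Type*) [Field K] where
  carrier : Set (π → K)
  basis : Finset (MvPolynomial τ (MvPolynomial π K))

/-- The basis `B` is primitive (content `1` over `K[π]`, up to units), its leading power products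
are pairwise distinct, its leading coefficients vanish nowhere on the segment, and at every point
of the segment it specializes, after division by the (nonzero) leading coefficients,
to the reduced Gröbner basis of the specialized ideal. -/
structure Segment.IsReduced {K π τ : Type*} [Field K] (m : MonomialOrder τ)
    (I : Ideal (MvPolynomial τ (MvPolynomial π K))) (s : Segment K π τ) : Prop where
  primitive : ∀ b ∈ s.basis, ∀ c : MvPolynomial π K, C c ∣ b → IsUnit c
  injOn_degree : Set.InjOn m.degree (s.basis : Set (MvPolynomial τ (MvPolynomial π K)))
  leadingCoeff_ne_zero : ∀ b ∈ s.basis, ∀ u ∈ s.carrier, eval u (m.leadingCoeff b) ≠ 0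
  specializes : ∀ u ∈ s.carrier, IsReducedGroebnerBasis m (I.map (specialize u))
    ((fun b => C (eval u (m.leadingCoeff b))⁻¹ * specialize u b) '' (s.basis : Set _))

/-- A finite set of reduced segments that forms a partition of the parameter space into
(nonempty) constructible sets. -/
structure IsReducedGroebnerSystem {K π τ : Type*} [Field K] (m : MonomialOrder τ)
    (I : Ideal (MvPolynomial τ (MvPolynomial π K))) (G : Finset (Segment K π τ)) : Prop where
  constructible : ∀ s ∈ G, @Topology.IsConstructible _ (zariski K π) s.carrier
  nonempty : ∀ s ∈ G, s.carrier.Nonempty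
  disjoint : (G : Set (Segment K π τ)).PairwiseDisjoint Segment.carrier
  cover : ∀ u : π → K, ∃ s ∈ G, u ∈ s.carrier
  reduced : ∀ s ∈ G, s.IsReduced m I

/-- A minimal (canonical) comprehensive Gröbner system of `I`: a reduced Gröbner system with the
least number of segments. In particular no two segments can be merged, so that two segments
have no common basis and at most one segment has basis `1`. -/
structure IsMCCGS {K π τ : Type*} [Field K] (m : MonomialOrder τ)
    (I : Ideal (MvPolynomial τ (MvPolynomial π K))) (G : Finset (Segment K π τ)) : Prop where
  isReducedGroebnerSystem : IsReducedGroebnerSystem m I G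
  minimal : ∀ G' : Finset (Segment K π τ), IsReducedGroebnerSystem m I G' → G.card ≤ G'.card

/-- A segment is generic if it contains a nonempty Zariski-open subset of the parameter space. -/
def Segment.IsGeneric {K π τ : Type*} [Field K] (s : Segment K π τ) : Prop :=
  ∃ O : Set (π → K), @IsOpen _ (zariski K π) O ∧ O.Nonempty ∧ O ⊆ s.carrier

/-- The basis of the segment is `1`, up to the nonzero scalar of `K` that the normalization to
content `1` leaves free. -/
def Segment.BasisIsOne {K π τ : Type*} [Field K] (s : Segment K π τ) : Prop :=
  ∃ c : K, c ≠ 0 ∧ s.basis = {C (C c)}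

/-! ### Choosing some of the variables as parameters -/

open Classical in
/-- The isomorphism `K[X] → K[U][X ∖ U]`. -/
def toParametric (K : Type*) {σ : Type*} [Field K] (U : Finset σ) :
    MvPolynomial σ K →ₐ[K] MvPolynomial {i // i ∉ U} (MvPolynomial {i // i ∈ U} K) :=
  aeval fun i => if h : i ∈ U then C (X ⟨i, h⟩) else X ⟨i, h⟩

/-- The ideal `I` of `K[X]` seen as a parametric ideal, i.e. an ideal of `K[U][X ∖ U]`. -/
def parametricIdeal {K σ : Type*} [Field K] (U : Finset σ) (I : Ideal (MvPolynomial σ K)) :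
    Ideal (MvPolynomial {i // i ∉ U} (MvPolynomial {i // i ∈ U} K)) :=
  I.map (toParametric K U)

end ParametricGroebner

end

open MvPolynomial Topology

/-! Part 1: if `(H + T) ∩ K[U] = 0`, some prime `P ⊇ H + T` still misses `K[U] \ {0}`. Then `K[U]`
embeds in `K[X]/P`, so `dim K[X]/P ≥ |U| = dim K[X]/H`, which forces `P` to be minimal over `H`: its
zero locus is the required component. Conversely `H + T` lies in the vanishing ideal of such a
component.

Part 2: `K^U` is irreducible, so exactly one segment of a finite constructible partition contains a
nonempty open set. The basis of a segment is `1` iff the specialized ideal is the unit ideal at one,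
equivalently every, point of it. A nonzero `g` in the elimination ideal makes it so wherever `g(u) ≠
0`; if there is none, the Nullstellensatz gives zeros of `H + T` over every nonempty open set of
parameters. -/

/-! ### Krull dimension of finitely generated domains -/

section KrullDimension

/-- An injective integral ring extension does not lower the Krull dimension. -/
theorem ringKrullDim_le_of_isIntegral_of_injective {R S : Type*} [CommRing R] [CommRing S]
    [Algebra R S] [Algebra.IsIntegral R S] (hinj : Function.Injective (algebraMap R S)) :
    ringKrullDim R ≤ ringKrullDim S := by
  refine iSup_le fun l => ?_
  -- Lying over the head of the chain; injectivity makes `⊥` contract to `⊥`. Going-up then lifts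
  -- the whole chain.
  obtain ⟨P, -, hP, hPl⟩ := Ideal.exists_ideal_over_prime_of_isIntegral
    (RelSeries.head l).asIdeal (⊥ : Ideal S)
    (by simp [← RingHom.ker_eq_comap_bot, (RingHom.injective_iff_ker_eq_bot _).1 hinj])
  have : P.LiesOver (RelSeries.head l).asIdeal := ⟨hPl.symm⟩
  obtain ⟨L, hL, -⟩ := Ideal.exists_ltSeries_of_hasGoingUp l P
  rw [← hL]
  exact Order.LTSeries.length_le_krullDim L

/-- A finitely generated domain over a field has Krull dimension at least the number of elements
of any algebraically independent family. -/
theorem natCard_le_ringKrullDim_of_injective {k A ι : Type*} [Field k] [CommRing A] [IsDomain A]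
    [Algebra k A] [Algebra.FiniteType k A] [Finite ι] (f : MvPolynomial ι k →ₐ[k] A)
    (hf : Function.Injective f) : (Nat.card ι : WithBot ℕ∞) ≤ ringKrullDim A := by
  obtain ⟨s, g, hg, hgi⟩ := exists_integral_inj_algHom_of_fg k A
  algebraize [g.toRingHom]
  have hinj : Function.Injective (algebraMap (MvPolynomial (Fin s) k) A) := hg
  have hdim := ringKrullDim_le_of_isIntegral_of_injective hinj
  have : FaithfulSMul (MvPolynomial (Fin s) k) A :=
    (faithfulSMul_iff_algebraMap_injective _ _).2 hinj
  have : IsScalarTower k (MvPolynomial (Fin s) k) A := .of_algebraMap_eq' g.comp_algebraMap.symm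
  -- Noether normalization makes `A` algebraic over `k[x₁, …, x_s]`, so its transcendence degree is
  -- `s`, and it bounds the size of `ι`.
  have h₁ := lift_trdeg_add_eq k (MvPolynomial (Fin s) k) A
  have h₂ := lift_trdeg_le_of_injective f hf
  rw [trdeg_eq_zero (R := MvPolynomial (Fin s) k)] at h₁
  have hle : Nat.card ι ≤ s := by
    have := Fintype.ofFinite ι
    simp only [trdeg_of_isDomain, Cardinal.mk_fintype, Fintype.card_fin, Cardinal.lift_natCast,
      Cardinal.lift_zero, add_zero, Cardinal.nat_eq_lift_iff, Cardinal.nat_le_lift_iff]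
      at h₁ h₂
    rw [← h₁, Nat.cast_le] at h₂
    rwa [Nat.card_eq_fintype_card]
  refine le_trans ?_ hdim
  rw [MvPolynomial.ringKrullDim_of_isNoetherianRing, ringKrullDim_eq_zero_of_field]
  simpa using hle

/-- A prime ideal containing `I` is minimal over `I` as soon as its quotient has (finite) Krull
dimension at least that of the quotient by `I`. -/
theorem Ideal.mem_minimalPrimes_of_ringKrullDim_le {R : Type*} [CommRing R] {I P : Ideal R}
    [hP : P.IsPrime] (hIP : I ≤ P) {n : ℕ} (hI : ringKrullDim (R ⧸ I) ≤ n)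
    (hn : n ≤ ringKrullDim (R ⧸ P)) : P ∈ I.minimalPrimes := by
  refine ⟨⟨hP, hIP⟩, fun Q ⟨hQ, hIQ⟩ hQP => ?_⟩
  by_contra hPQ
  obtain ⟨r, hrP, hrQ⟩ := Set.not_subset.1 hPQ
  have hr : Ideal.Quotient.mk Q r ∈ nonZeroDivisors (R ⧸ Q) :=
    mem_nonZeroDivisors_of_ne_zero (by rwa [Ne, Ideal.Quotient.eq_zero_iff_mem])
  have h₁ := ringKrullDim_succ_le_of_surjective (Ideal.Quotient.factor hQP)
    (Ideal.Quotient.factor_surjective hQP) hr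
    (by simpa [Ideal.Quotient.eq_zero_iff_mem] using hrP)
  have h₂ := ringKrullDim_le_of_surjective (Ideal.Quotient.factor hIQ)
    (Ideal.Quotient.factor_surjective hIQ)
  -- Contradictory only because `n` is finite: `x + 1 ≤ x` holds for `⊥` and `⊤`.
  have h₃ : ((n : WithBot ℕ∞) + 1) ≤ n := by
    calc (n : WithBot ℕ∞) + 1 ≤ ringKrullDim (R ⧸ P) + 1 := by gcongr
      _ ≤ n := h₁.trans (h₂.trans hI)
  have : n + 1 ≤ n := by exact_mod_cast h₃
  omega

end KrullDimension

/-! ### Open and constructible sets in irreducible spaces -/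

section Constructible

/-- In an irreducible space, a constructible set or its complement contains a nonempty open
set. -/
theorem Topology.IsConstructible.exists_isOpen_subset_or_compl {X : Type*} [TopologicalSpace X]
    [IrreducibleSpace X] {s : Set X} (hs : Topology.IsConstructible s) :
    (∃ O, IsOpen O ∧ O.Nonempty ∧ O ⊆ s) ∨ ∃ O, IsOpen O ∧ O.Nonempty ∧ O ⊆ sᶜ := by
  induction hs using Topology.IsConstructible.empty_union_induction with
  | open_retrocompact V hV _ =>
    rcases V.eq_empty_or_nonempty with rfl | hne
    · exact .inr ⟨Set.univ, isOpen_univ, Set.univ_nonempty, by simp⟩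
    · exact .inl ⟨V, hV, hne, subset_rfl⟩
  | union s _ t _ hs ht =>
    rcases hs with ⟨O, hO, hne, h⟩ | ⟨O, hO, hne, h⟩
    · exact .inl ⟨O, hO, hne, h.trans Set.subset_union_left⟩
    rcases ht with ⟨O', hO', hne', h'⟩ | ⟨O', hO', hne', h'⟩
    · exact .inl ⟨O', hO', hne', h'.trans Set.subset_union_right⟩
    · exact .inr ⟨O ∩ O', hO.inter hO', nonempty_preirreducible_inter hO hO' hne hne',
        by rw [Set.compl_union]; exact Set.inter_subset_inter h h'⟩
  | compl s _ hs => simpa using hs.symm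

/-- In an irreducible space, one of the members of a finite cover by constructible sets contains
a nonempty open set. -/
theorem Topology.IsConstructible.exists_isOpen_subset_of_cover {X ι : Type*} [TopologicalSpace X]
    [IrreducibleSpace X] (G : Finset ι) (f : ι → Set X)
    (hf : ∀ i ∈ G, Topology.IsConstructible (f i)) (hcover : ∀ x, ∃ i ∈ G, x ∈ f i) :
    ∃ i ∈ G, ∃ O, IsOpen O ∧ O.Nonempty ∧ O ⊆ f i := by
  by_contra! hno
  -- If no member contains a nonempty open set, all complements do; finitely many such sets meet,
  -- against the cover.
  have key : ∀ G' ⊆ G, ∃ O, IsOpen O ∧ O.Nonempty ∧ ∀ i ∈ G', O ⊆ (f i)ᶜ := by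
    intro G'
    induction G' using Finset.cons_induction with
    | empty => exact fun _ => ⟨Set.univ, isOpen_univ, Set.univ_nonempty, by simp⟩
    | cons i G' hi ih =>
      intro hG'
      obtain ⟨O, hO, hne, h⟩ := ih ((Finset.subset_cons hi).trans hG')
      have hiG : i ∈ G := hG' (Finset.mem_cons_self i G')
      obtain ⟨O', hO', hne', h'⟩ := (hf i hiG).exists_isOpen_subset_or_compl.resolve_left
        fun ⟨O', hO', hne', h'⟩ => hno i hiG O' hO' hne' h'
      refine ⟨O ∩ O', hO.inter hO', nonempty_preirreducible_inter hO hO' hne hne', ?_⟩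
      simp only [Finset.mem_cons, forall_eq_or_imp]
      exact ⟨Set.inter_subset_right.trans h', fun j hj => Set.inter_subset_left.trans (h j hj)⟩
  obtain ⟨O, -, ⟨x, hx⟩, h⟩ := key G subset_rfl
  obtain ⟨i, hi, hxi⟩ := hcover x
  exact h i hi hx hxi

end Constructible

namespace ParametricGroebner

/-! ### The Zariski topology on affine space -/

section Zariski

variable {K σ : Type*} [Field K]

theorem isClosed_zariski_iff {Z : Set (σ → K)} :
    IsClosed[zariski K σ] Z ↔ ∃ I : Ideal (MvPolynomial σ K), Z = zeroLocus K I := by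
  rw [← @isOpen_compl_iff _ _ (zariski K σ)]
  change Zᶜᶜ ∈ {Z | ∃ I : Ideal (MvPolynomial σ K), Z = zeroLocus K I} ↔ _
  rw [compl_compl]
  rfl

/-- A nonempty open set contains a nonempty basic open set. -/
theorem exists_eval_ne_zero_subset {O : Set (σ → K)} (hO : IsOpen[zariski K σ] O)
    (hne : O.Nonempty) : ∃ f : MvPolynomial σ K, f ≠ 0 ∧ {u | eval u f ≠ 0} ⊆ O := by
  obtain ⟨x, hx⟩ := hne
  rw [← @isClosed_compl_iff _ (zariski K σ), isClosed_zariski_iff] at hO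
  obtain ⟨I, hI⟩ := hO
  have hxI : x ∉ zeroLocus K I := by rw [← hI]; simpa using hx
  simp only [mem_zeroLocus_iff, not_forall] at hxI
  obtain ⟨f, hf, hfx⟩ := hxI
  refine ⟨f, by rintro rfl; simp at hfx, fun u hu => ?_⟩
  by_contra huO
  have : u ∈ zeroLocus K I := by rw [← hI]; exact huO
  exact hu (by simpa [aeval_eq_eval] using this f hf)

theorem irreducibleSpace_zariski [Infinite K] : @IrreducibleSpace (σ → K) (zariski K σ) := by
  let _ := zariski K σ
  refine @IrreducibleSpace.mk _ _ ⟨?_⟩ ⟨0⟩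
  rintro O O' hO hO' ⟨x, -, hx⟩ ⟨y, -, hy⟩
  obtain ⟨f, hf, hfO⟩ := exists_eval_ne_zero_subset hO ⟨x, hx⟩
  obtain ⟨g, hg, hgO⟩ := exists_eval_ne_zero_subset hO' ⟨y, hy⟩
  obtain ⟨u, hu⟩ : ∃ u, eval u (f * g) ≠ 0 := by
    by_contra! h
    exact mul_ne_zero hf hg (MvPolynomial.funext fun u => by simpa using h u)
  rw [map_mul] at hu
  exact ⟨u, trivial, hfO (left_ne_zero_of_mul hu), hgO (right_ne_zero_of_mul hu)⟩

/-- By the Nullstellensatz `P` is the full vanishing ideal, so a cover by `V(I)` and `V(J)` gives `I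
* J ≤ P`. -/
theorem isIrreducible_zeroLocus [IsAlgClosed K] [Finite σ] (P : Ideal (MvPolynomial σ K))
    [hP : P.IsPrime] : @IsIrreducible _ (zariski K σ) (zeroLocus K P) := by
  let _ := zariski K σ
  have hvan : vanishingIdeal K (zeroLocus K P) = P := IsPrime.vanishingIdeal_zeroLocus P
  constructor
  · rw [Set.nonempty_iff_ne_empty]
    intro h
    rw [h, vanishingIdeal_empty] at hvan
    exact hP.ne_top hvan.symm
  · rw [isPreirreducible_iff_isClosed_union_isClosed]
    intro Z₁ Z₂ h₁ h₂ hsub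
    obtain ⟨I, rfl⟩ := isClosed_zariski_iff.1 h₁
    obtain ⟨J, rfl⟩ := isClosed_zariski_iff.1 h₂
    have hle : I * J ≤ P := by
      rw [← hvan, Ideal.mul_le]
      intro p hp q hq x hx
      rw [map_mul]
      rcases hsub hx with h | h
      · rw [h p hp, zero_mul]
      · rw [h q hq, mul_zero]
    exact (hP.mul_le.1 hle).imp (zeroLocus_anti_mono ·) (zeroLocus_anti_mono ·)

theorem isPrime_vanishingIdeal {Z : Set (σ → K)} (hZ : @IsIrreducible _ (zariski K σ) Z) :
    (vanishingIdeal K Z : Ideal (MvPolynomial σ K)).IsPrime := by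
  let _ := zariski K σ
  obtain ⟨⟨z, hz⟩, hirr⟩ := hZ
  rw [isPreirreducible_iff_isClosed_union_isClosed] at hirr
  refine ⟨fun h => ?_, fun {p q} hpq => ?_⟩
  · have : (1 : MvPolynomial σ K) ∈ vanishingIdeal K Z := h ▸ Submodule.mem_top
    simpa using this z hz
  · have := hirr (zeroLocus K (.span {p})) (zeroLocus K (.span {q}))
      (isClosed_zariski_iff.2 ⟨_, rfl⟩) (isClosed_zariski_iff.2 ⟨_, rfl⟩) (fun x hx => by
        simpa [zeroLocus_span] using hpq x hx)
    simpa [zeroLocus_span, Set.subset_def] using this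

/-- The zero locus of a minimal prime of `H` is an irreducible component of the zero locus of
`H`. -/
theorem isComponent_zeroLocus [IsAlgClosed K] [Finite σ] {H P : Ideal (MvPolynomial σ K)}
    (hP : P ∈ H.minimalPrimes) : IsComponent (zeroLocus K H) (zeroLocus K P) := by
  have := hP.1.1
  refine ⟨⟨isIrreducible_zeroLocus P, zeroLocus_anti_mono hP.1.2⟩, fun Z ⟨hZ, hZH⟩ hPZ => ?_⟩
  -- A larger irreducible `Z` yields a prime between `H` and `P`, which minimality identifies with
  -- `P`.
  have hZP : vanishingIdeal K Z ≤ P := by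
    rw [← IsPrime.vanishingIdeal_zeroLocus (K := K) P]
    exact vanishingIdeal_anti_mono hPZ
  exact le_zeroLocus_iff_le_vanishingIdeal.2
    (hP.2 ⟨isPrime_vanishingIdeal hZ, le_zeroLocus_iff_le_vanishingIdeal.1 hZH⟩ hZP)

end Zariski

/-! ### Independent components -/

section Independent

variable {K σ : Type*} [Field K] {U : Finset σ} {H T I J : Ideal (MvPolynomial σ K)}

theorem IsIndependent.mono (hJ : IsIndependent U J) (h : I ≤ J) : IsIndependent U I :=
  le_bot_iff.1 ((Ideal.comap_mono h).trans hJ.le)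

theorem isIndependent_iff : IsIndependent U I ↔
    ∀ g : MvPolynomial {i // i ∈ U} K, rename (↑) g ∈ I → g = 0 :=
  eq_bot_iff

/-- A set of independent variables remains independent modulo some prime ideal. -/
theorem IsIndependent.exists_isPrime (hI : IsIndependent U I) :
    ∃ P : Ideal (MvPolynomial σ K), P.IsPrime ∧ I ≤ P ∧ IsIndependent U P := by
  let φ : MvPolynomial {i // i ∈ U} K →ₐ[K] MvPolynomial σ K := rename (↑)
  have hdisj : ∀ L : Ideal (MvPolynomial σ K),
      Disjoint (L : Set (MvPolynomial σ K)) ((nonZeroDivisors _).map φ) ↔ IsIndependent U L := by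
    intro L
    rw [isIndependent_iff, Set.disjoint_left]
    constructor
    · intro h g hg
      by_contra hg0
      exact h hg ⟨g, mem_nonZeroDivisors_of_ne_zero hg0, rfl⟩
    · rintro h _ hL ⟨g, hg, rfl⟩
      exact nonZeroDivisors.ne_zero hg (h g hL)
  obtain ⟨P, hP, hIP, hPd⟩ := Ideal.exists_le_prime_disjoint I _ ((hdisj I).2 hI)
  exact ⟨P, hP, hIP, (hdisj P).1 hPd⟩

theorem IsIndependent.card_le_ringKrullDim [Finite σ] {P : Ideal (MvPolynomial σ K)} [P.IsPrime]
    (hP : IsIndependent U P) : (U.card : WithBot ℕ∞) ≤ ringKrullDim (MvPolynomial σ K ⧸ P) := by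
  have := natCard_le_ringKrullDim_of_injective
    ((Ideal.Quotient.mkₐ K P).comp (rename ((↑) : {i // i ∈ U} → σ)))
    ((injective_iff_map_eq_zero _).2 fun g hg => isIndependent_iff.1 hP g (by
      simpa [Ideal.Quotient.eq_zero_iff_mem] using hg))
  simpa using this

theorem vanishesOnSomeIndependentComponent_iff [IsAlgClosed K] [Finite σ]
    (hdim : ringKrullDim (MvPolynomial σ K ⧸ H) ≤ U.card) :
    VanishesOnSomeIndependentComponent U H T ↔ IsIndependent U (H ⊔ T) := by
  constructor
  · rintro ⟨C, hC, hUC, hT⟩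
    exact hUC.mono (sup_le (le_zeroLocus_iff_le_vanishingIdeal.1 hC.1.2) fun t ht x hx => by
      simpa [aeval_eq_eval] using hT t ht x hx)
  · intro h
    obtain ⟨P, hP, hle, hUP⟩ := h.exists_isPrime
    have hmin : P ∈ H.minimalPrimes :=
      Ideal.mem_minimalPrimes_of_ringKrullDim_le (le_sup_left.trans hle) hdim
        hUP.card_le_ringKrullDim
    refine ⟨zeroLocus K P, isComponent_zeroLocus hmin, ?_, fun t ht x hx => ?_⟩
    · rwa [IsPrime.vanishingIdeal_zeroLocus P]
    · simpa [aeval_eq_eval] using hx t (hle (le_sup_right (a := H) ht))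

end Independent

/-! ### Specialization of the parameters -/

section Specialization

variable {K σ : Type*} [Field K] {U : Finset σ}

theorem toParametric_rename (g : MvPolynomial {i // i ∈ U} K) :
    toParametric K U (rename (↑) g) = C g := by
  induction g using MvPolynomial.induction_on with
  | C a => simp [toParametric]
  | add p q hp hq => simp [hp, hq]
  | mul_X p i hp => rw [map_mul, map_mul, hp, rename_X, map_mul]; simp [toParametric]

/-- Evaluation in two stages: a point of `V(I)` above `u` is thereby a zero of the ideal specialized
at `u`. -/
theorem eval_specialize_toParametric (x : σ → K) (p : MvPolynomial σ K) :
    eval (fun i : {i // i ∉ U} => x i) (specialize (fun i : {i // i ∈ U} => x i)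
      (toParametric K U p)) = eval x p := by
  induction p using MvPolynomial.induction_on with
  | C a =>
    have : toParametric K U (C a) = C (C a) := by simp [toParametric]
    simp [this, specialize]
  | add p q hp hq => simp [hp, hq]
  | mul_X p i hp =>
    rw [map_mul, map_mul, map_mul, map_mul, hp]
    by_cases h : i ∈ U <;> simp [toParametric, h, specialize]

/-- Over a point of the zero locus of `I`, the specialized ideal is proper. -/
theorem map_specialize_parametricIdeal_ne_top {I : Ideal (MvPolynomial σ K)} {x : σ → K}
    (hx : x ∈ zeroLocus K I) :
    (parametricIdeal U I).map (specialize fun i : {i // i ∈ U} => x i) ≠ ⊤ := by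
  have hle : (parametricIdeal U I).map (specialize fun i : {i // i ∈ U} => x i) ≤
      RingHom.ker (eval fun i : {i // i ∉ U} => x i) := by
    rw [parametricIdeal, Ideal.map_le_iff_le_comap, Ideal.map_le_iff_le_comap]
    intro p hp
    change eval _ (specialize _ (toParametric K U p)) = 0
    rw [eval_specialize_toParametric]
    simpa [aeval_eq_eval] using hx p hp
  intro h
  exact RingHom.ker_ne_top _ (top_le_iff.1 (h ▸ hle))

/-- At a point where an element of the elimination ideal does not vanish, the specialized ideal is
the unit ideal. -/
theorem map_specialize_parametricIdeal_eq_top {I : Ideal (MvPolynomial σ K)}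
    {g : MvPolynomial {i // i ∈ U} K} (hg : rename (↑) g ∈ I) {u : {i // i ∈ U} → K}
    (hu : eval u g ≠ 0) : (parametricIdeal U I).map (specialize u) = ⊤ := by
  have h := Ideal.mem_map_of_mem (specialize (τ := {i // i ∉ U}) u)
    (Ideal.mem_map_of_mem (toParametric K U) hg)
  rw [toParametric_rename, specialize, map_C] at h
  exact Ideal.eq_top_of_isUnit_mem _ h ((isUnit_iff_ne_zero.2 hu).map C)

/-- If `U` is independent for `I`, then `I` has zeros over every nonempty open set of parameters. -/
theorem IsIndependent.exists_mem_zeroLocus [IsAlgClosed K] [Finite σ]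
    {I : Ideal (MvPolynomial σ K)} (hI : IsIndependent U I) {f : MvPolynomial {i // i ∈ U} K}
    (hf : f ≠ 0) : ∃ x ∈ zeroLocus K I, eval (fun i : {i // i ∈ U} => x i) f ≠ 0 := by
  by_contra! h
  have hmem : rename (↑) f ∈ vanishingIdeal K (zeroLocus K I) := fun x hx => by
    rw [aeval_eq_eval, eval_rename]
    exact h x hx
  rw [vanishingIdeal_zeroLocus_eq_radical] at hmem
  obtain ⟨n, hn⟩ := hmem
  rw [← map_pow] at hn
  exact pow_ne_zero n hf (isIndependent_iff.1 hI _ hn)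

end Specialization

/-! ### Reduced bases of the unit ideal -/

section UnitIdeal

theorem IsReducedGroebnerBasis.eq_singleton_one {K τ : Type*} [Field K] {m : MonomialOrder τ}
    {B : Set (MvPolynomial τ K)} (hB : IsReducedGroebnerBasis m ⊤ B) : B = {1} := by
  -- `≤` on degrees is componentwise, i.e. divisibility of monomials, so `b` is constant.
  obtain ⟨b, hb, hdeg⟩ := hB.exists_degree_le 1 Submodule.mem_top one_ne_zero
  rw [m.degree_one, nonpos_iff_eq_zero] at hdeg
  have hb1 : b = 1 := by
    rw [m.eq_C_of_degree_eq_zero hdeg, hB.monic b hb, C_1]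
  subst hb1
  refine Set.eq_singleton_iff_unique_mem.2 ⟨hb, fun b' hb' => ?_⟩
  by_contra hne
  have hb0 : b' ≠ 0 := by
    rintro rfl
    simpa using hB.monic 0 hb'
  exact hB.reduced b' hb' 1 hb hne _ (m.degree_mem_support hb0) (by simp)

theorem IsReducedGroebnerBasis.eq_top_of_one_mem {K τ : Type*} [Field K] {m : MonomialOrder τ}
    {J : Ideal (MvPolynomial τ K)} {B : Set (MvPolynomial τ K)}
    (hB : IsReducedGroebnerBasis m J B) (h : 1 ∈ B) : J = ⊤ :=
  (Ideal.eq_top_iff_one _).2 (hB.subset h)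

variable {K π τ : Type*} [Field K] {m : MonomialOrder τ}
  {I : Ideal (MvPolynomial τ (MvPolynomial π K))} {s : Segment K π τ}

theorem Segment.IsReduced.map_specialize_eq_top (hs : s.IsReduced m I) (h1 : s.BasisIsOne)
    {u : π → K} (hu : u ∈ s.carrier) : I.map (specialize u) = ⊤ := by
  obtain ⟨c, hc, hB⟩ := h1
  refine (hs.specializes u hu).eq_top_of_one_mem ⟨C (C c), by simp [hB], ?_⟩
  simp [specialize, ← C_mul, inv_mul_cancel₀ hc]

/-- A single point suffices: leading coefficients survive specialization there, so a reduced basis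
`{1}` forces every element of `s.basis` to have degree zero. -/
theorem Segment.IsReduced.basisIsOne (hs : s.IsReduced m I) {u : π → K} (hu : u ∈ s.carrier)
    (htop : I.map (specialize u) = ⊤) : s.BasisIsOne := by
  have himg := (htop ▸ hs.specializes u hu).eq_singleton_one
  have hdeg : ∀ b ∈ s.basis, m.degree b = 0 := by
    intro b hb
    have h1 : C (eval u (m.leadingCoeff b))⁻¹ * specialize u b = 1 := by
      have := Set.mem_image_of_mem
        (fun b => C (eval u (m.leadingCoeff b))⁻¹ * specialize u b) (Finset.mem_coe.2 hb)
      rwa [himg] at this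
    classical
    have hlc := hs.leadingCoeff_ne_zero b hb u hu
    have hcoeff := congrArg (coeff (m.degree b)) h1
    rw [coeff_C_mul, specialize, coeff_map, ← MonomialOrder.leadingCoeff,
      inv_mul_cancel₀ hlc, coeff_one] at hcoeff
    by_contra h0
    rw [if_neg (Ne.symm h0)] at hcoeff
    exact one_ne_zero hcoeff
  obtain ⟨b, hb, -⟩ : (1 : MvPolynomial τ K) ∈
      (fun b => C (eval u (m.leadingCoeff b))⁻¹ * specialize u b) '' (s.basis : Set _) := by
    rw [himg]; rfl
  have hbC := m.eq_C_of_degree_eq_zero (hdeg b hb)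
  -- `b` is its own leading coefficient, which therefore divides it; content `1` makes it a scalar.
  have hunit := hs.primitive b hb (m.leadingCoeff b) (by rw [← hbC])
  obtain ⟨c, hc, hcb⟩ := MvPolynomial.isUnit_iff_eq_C_of_isReduced.1 hunit
  refine ⟨c, hc.ne_zero, Finset.eq_singleton_iff_unique_mem.2 ⟨?_, fun b' hb' => ?_⟩⟩
  · rw [← hcb, ← hbC]; exact hb
  · rw [← hcb, ← hbC]
    exact hs.injOn_degree hb' hb ((hdeg b' hb').trans (hdeg b hb).symm)

end UnitIdeal

/-! ### Generic segments -/

section Generic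

theorem IsReducedGroebnerSystem.existsUnique_isGeneric {K π τ : Type*} [Field K] [Infinite K]
    {m : MonomialOrder τ} {I : Ideal (MvPolynomial τ (MvPolynomial π K))}
    {G : Finset (Segment K π τ)} (hG : IsReducedGroebnerSystem m I G) :
    ∃! s, s ∈ G ∧ s.IsGeneric := by
  let _ := zariski K π
  have := irreducibleSpace_zariski (K := K) (σ := π)
  obtain ⟨s, hs, hgen⟩ := Topology.IsConstructible.exists_isOpen_subset_of_cover G
    Segment.carrier hG.constructible hG.cover
  refine ⟨s, ⟨hs, hgen⟩, fun t ⟨ht, O', hO', hne', h'⟩ => ?_⟩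
  obtain ⟨O, hO, hne, h⟩ := hgen
  by_contra hts
  obtain ⟨u, hu, hu'⟩ := nonempty_preirreducible_inter hO hO' hne hne'
  exact Set.disjoint_left.1 (hG.disjoint ht hs hts) (h' hu') (h hu)

theorem Segment.IsReduced.basisIsOne_iff_not_isIndependent {K σ : Type*} [Field K]
    [IsAlgClosed K] [Finite σ] {U : Finset σ} {I : Ideal (MvPolynomial σ K)}
    {m : MonomialOrder {i // i ∉ U}} {s : Segment K {i // i ∈ U} {i // i ∉ U}}
    (hs : s.IsReduced m (parametricIdeal U I)) (hgen : s.IsGeneric) :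
    s.BasisIsOne ↔ ¬ IsIndependent U I := by
  obtain ⟨O, hO, hne, hOs⟩ := hgen
  obtain ⟨f, hf, hfO⟩ := exists_eval_ne_zero_subset hO hne
  constructor
  · intro h1 hI
    obtain ⟨x, hx, hxf⟩ := hI.exists_mem_zeroLocus hf
    exact map_specialize_parametricIdeal_ne_top hx
      (hs.map_specialize_eq_top h1 (hOs (hfO hxf)))
  · intro hI
    simp only [isIndependent_iff, not_forall] at hI
    obtain ⟨g, hg, hg0⟩ := hI
    -- The factor `f` keeps `u` in the segment, and `g` makes the specialized ideal the unit ideal.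
    obtain ⟨u, hu⟩ : ∃ u, eval u (f * g) ≠ 0 := by
      by_contra! h
      exact mul_ne_zero hf hg0 (MvPolynomial.funext fun u => by simpa using h u)
    rw [map_mul] at hu
    exact hs.basisIsOne (hOs (hfO (left_ne_zero_of_mul hu)))
      (map_specialize_parametricIdeal_eq_top hg (right_ne_zero_of_mul hu))

end Generic

end ParametricGroebner

open ParametricGroebner in
theorem proposition8 {K σ : Type*} [Field K] [IsAlgClosed K] [Finite σ]
    (H T : Ideal (MvPolynomial σ K)) (U : Finset σ) (hU : IsIndependent U H)
    (hdim : ringKrullDim (MvPolynomial σ K ⧸ H) = U.card)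
    (m : MonomialOrder {i // i ∉ U}) :
    (VanishesOnSomeIndependentComponent U H T ↔ IsIndependent U (H ⊔ T)) ∧
    ∀ G : Finset (Segment K {i // i ∈ U} {i // i ∉ U}),
      IsMCCGS m (parametricIdeal U (H ⊔ T)) G →
        (∃! s, s ∈ G ∧ s.IsGeneric) ∧
        ∀ s ∈ G, s.IsGeneric →
          (VanishesOnSomeIndependentComponent U H T ↔ ¬ s.BasisIsOne) := by
  have hiff := vanishesOnSomeIndependentComponent_iff (T := T) hdim.le
  refine ⟨hiff, fun G hG => ?_⟩
  have hsys := hG.isReducedGroebnerSystem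
  refine ⟨hsys.existsUnique_isGeneric, fun s hs hgen => ?_⟩
  rw [hiff, (hsys.reduced s hs).basisIsOne_iff_not_isIndependent hgen, not_not]
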